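/- **Setting.** Let $g\colon[0,1]\to[0,1]$ be a concave, absolutely continuous distortion function (non-decreasing, $g(0)=0$, $g(1)=1$). Let $\gamma(u)=\partial_-g(x)|_{x=1-u}$, $0<u<1$, be its weight function (left derivative of $g$ at $1-u$), and assume $\int_0^1\gamma(u)^2\,du<\infty$ and $\gamma\not\equiv1$. For a probability distribution function $G$ on $\mathbb R$ with finite second moment let $$H_g(G)=-\int_{-\infty}^0\bigl(1-g(1-G(x))\bigr)\,dx+\int_0^{\infty}g(1-G(x))\,dx$$ be the associated distortion risk measure, and let $G^{-1}(u)=\inf\{y: G(y)\ge u\}$ be the quantile function of $G$. Let $d_W$ denote the Wasserstein distance of order $2$ on $\mathbb R$, i.e. the infimum of $(\mathbb E(X_1-X_2)^2)^{1/2}$ over all couplings of the two given distributions. Let $n\in\mathbb N$, $\boldsymbol\mu\in\mathbb R^n$, let $\Sigma\in\mathbb R^{n\times n}$ be a (symmetric positive semidefinite) covariance matrix, and let $\mathcal P\subseteq\mathbb R^n$ be a set of portfolios (for instance a polyhedral set). Write $\mathcal M(\boldsymbol\mu,\Sigma)$ for the set of all distributions on $\mathbb R^n$ with mean vector $\boldsymbol\mu$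 and covariance matrix $\Sigma$. For $x\in\mathcal P$ put $\mu_x=x^\top\boldsymbol\mu$ and $\sigma_x=\sqrt{x^\top\Sigma x}$, and for $G_{\boldsymbol R}\in\mathcal M(\boldsymbol\mu,\Sigma)$ let $G_x$ be the distribution of the loss $-x^\top\boldsymbol R$, where $\boldsymbol R\sim G_{\boldsymbol R}$. Let $F$ be a distribution on $\mathbb R$ with mean $0$ and variance $1$, and let the benchmark loss distribution $F_x$ be the law of $-\mu_x+\sigma_xZ$ with $Z\sim F$, that is, $F_x^{-1}(u)=-\mu_x+\sigma_xF^{-1}(u)$ for $0<u<1$. Let $U$ be uniform on $(0,1)$, $V=\operatorname{var}(\gamma(U))$ and $c_0=\operatorname{corr}(F^{-1}(U),\gamma(U))$. Finally, let $A\in[0,1]$ and $\varepsilon_x=2\sigma_x^2A$ for $x\in\mathcal P$. Consider the robust portfolio problem $$\min_{x\in\mathcal P}\ \max_{\substack{G_{\boldsymbol R}\in\mathcal M(\boldsymbol\mu,\Sigma)\\ d_W(F_x,G_x)\le\sqrt{\varepsilon_x}}}H_g(G_x).\qquad(\ast)$$ We say that $(\ast)$ is equivalent to $\min_{x\in\mathcal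 P}\phi(x)$ if for every $x\in\mathcal P$ the inner maximum is attained and equals $\phi(x)$, and the two problems have the same optimal value (infimum over $\mathcal P$) and the same minimisers. **Corollary.** The following holds. 1. If $A=0$, then $(\ast)$ is equivalent to $\displaystyle\min_{x\in\mathcal P}\bigl\{-\mu_x+\sigma_x\sqrt V\,c_0\bigr\}$. 2. If $0<A<1-c_0$, then $(\ast)$ is equivalent to $\displaystyle\min_{x\in\mathcal P}\bigl\{-\mu_x+\sigma_x\sqrt V\,\bigl(c_0(1-A)+\sqrt{A(2-A)}\sqrt{1-c_0^2}\bigr)\bigr\}$. 3. If $1-c_0\le A\le1$, then $(\ast)$ is equivalent to $\displaystyle\min_{x\in\mathcal P}\bigl\{-\mu_x+\sigma_x\sqrt V\bigr\}$. -/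

import Mathlib

open MeasureTheory ProbabilityTheory Set
open scoped ENNReal Matrix

noncomputable section

namespace RobustPortfolio

/-- A distortion function (only its values on `[0,1]` matter): non-decreasing on `[0,1]`
with `g 0 = 0` and `g 1 = 1`. -/
structure IsDistortion (g : ℝ → ℝ) : Prop where
  monotoneOn : MonotoneOn g (Icc 0 1)
  map_zero : g 0 = 0
  map_one : g 1 = 1

/-- The uniform distribution on `(0,1)`, i.e. the law of `U`. -/
def unif : Measure ℝ := volume.restrict (Ioo 0 1)

/-- The weight function `γ(u)`: the left derivative of `g` at `1 - u`, for `0 < u < 1`. -/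
def weight (g : ℝ → ℝ) (u : ℝ) : ℝ := derivWithin g (Iic (1 - u)) (1 - u)

/-- The left-continuous quantile function `G⁻¹(u) = inf {y | G(y) ≥ u}`, for `0 < u < 1`,
of a probability distribution on the line. -/
def quantile (G : Measure ℝ) (u : ℝ) : ℝ := sInf {y : ℝ | u ≤ cdf G y}

/-- The distortion risk measure `H_g`, as the Choquet integral
`- ∫_{-∞}^0 (1 - g (1 - G x)) dx + ∫_0^∞ g (1 - G x) dx`; both integrands are nonnegative and
the two integrals are taken in `[0, ∞]`. -/
def distortionRisk (g : ℝ → ℝ) (G : Measure ℝ) : EReal :=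
  ((∫⁻ x in Ioi (0 : ℝ), ENNReal.ofReal (g (1 - cdf G x)) : ℝ≥0∞) : EReal) -
    ((∫⁻ x in Iic (0 : ℝ), ENNReal.ofReal (1 - g (1 - cdf G x)) : ℝ≥0∞) : EReal)

/-- The Wasserstein distance of order 2 between two distributions on the line: the infimum of
`(E (X₁ - X₂)²) ^ (1/2)` over all bivariate distributions with the given marginals. -/
def wasserstein (G₁ G₂ : Measure ℝ) : ℝ≥0∞ :=
  ⨅ (π : Measure (ℝ × ℝ)) (_ : π.map Prod.fst = G₁ ∧ π.map Prod.snd = G₂),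
    (∫⁻ p, ENNReal.ofReal ((p.1 - p.2) ^ 2) ∂π) ^ (1 / 2 : ℝ)

/-- Pearson correlation of two real random variables. -/
def corr {Ω : Type*} [MeasurableSpace Ω] (X Y : Ω → ℝ) (P : Measure Ω) : ℝ :=
  cov[X, Y; P] / (√(Var[X; P]) * √(Var[Y; P]))

/-- `V = var(γ(U))`. -/
def weightVar (g : ℝ → ℝ) : ℝ := Var[weight g; unif]

/-- `c₀ = corr(F⁻¹(U), γ(U))`. -/
def corrCoeff (F : Measure ℝ) (g : ℝ → ℝ) : ℝ := corr (quantile F) (weight g) unif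

variable {n : ℕ}

/-- `μ_x = xᵀ μ`. -/
def portMean (m : Fin n → ℝ) (x : Fin n → ℝ) : ℝ := x ⬝ᵥ m

/-- `σ_x = √(xᵀ Σ x)`. -/
def portStd (S : Matrix (Fin n) (Fin n) ℝ) (x : Fin n → ℝ) : ℝ := √(x ⬝ᵥ (S *ᵥ x))

/-- The set of all distributions on `ℝⁿ` with mean vector `m` and covariance matrix `S`. -/
def momentSet (m : Fin n → ℝ) (S : Matrix (Fin n) (Fin n) ℝ) : Set (Measure (Fin n → ℝ)) :=
  {G | IsProbabilityMeasure G ∧ (∀ i, MemLp (fun r : Fin n → ℝ => r i) 2 G) ∧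
    (∀ i, ∫ r, r i ∂G = m i) ∧
    ∀ i j, cov[fun r : Fin n → ℝ => r i, fun r : Fin n → ℝ => r j; G] = S i j}

/-- The distribution `G_x` of the aggregate portfolio loss `-xᵀR`, where `R` has law `G`. -/
def lossLaw (G : Measure (Fin n → ℝ)) (x : Fin n → ℝ) : Measure ℝ :=
  G.map (fun r => -(x ⬝ᵥ r))

/-- The benchmark distribution `F_x` of the portfolio loss in the location-scale family of `F`:
the law of `-μ_x + σ_x Z` with `Z ∼ F`, with quantile function `-μ_x + σ_x F⁻¹(u)`. -/
def benchmark (F : Measure ℝ) (m : Fin n → ℝ) (S : Matrix (Fin n) (Fin n) ℝ)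
    (x : Fin n → ℝ) : Measure ℝ :=
  F.map (fun z => -portMean m x + portStd S x * z)

/-- The return distributions `G ∈ M(m, S)` whose loss distribution `G_x` lies within Wasserstein
distance `√ε_x` of the benchmark `F_x`. -/
def feasible (F : Measure ℝ) (m : Fin n → ℝ) (S : Matrix (Fin n) (Fin n) ℝ)
    (ε : (Fin n → ℝ) → ℝ) (x : Fin n → ℝ) : Set (Measure (Fin n → ℝ)) :=
  {G | G ∈ momentSet m S ∧
    wasserstein (benchmark F m S x) (lossLaw G x) ≤ ENNReal.ofReal (√(ε x))}

/-- The values `H_g(G_x)` over all feasible `G`. -/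
def riskValues (g : ℝ → ℝ) (F : Measure ℝ) (m : Fin n → ℝ) (S : Matrix (Fin n) (Fin n) ℝ)
    (ε : (Fin n → ℝ) → ℝ) (x : Fin n → ℝ) : Set EReal :=
  (fun G => distortionRisk g (lossLaw G x)) '' feasible F m S ε x

/-- The inner (worst-case) value of the robust portfolio problem. -/
def worstCase (g : ℝ → ℝ) (F : Measure ℝ) (m : Fin n → ℝ) (S : Matrix (Fin n) (Fin n) ℝ)
    (ε : (Fin n → ℝ) → ℝ) (x : Fin n → ℝ) : EReal :=
  sSup (riskValues g F m S ε x)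

/-- The robust problem `min_{x ∈ P} max_G H_g(G_x)` is equivalent to `min_{x ∈ P} obj x`:
for every `x ∈ P` the inner maximum is attained and equals `obj x`, the two problems have the same
optimal value, and they have the same minimisers. -/
def RobustProblemEquiv (g : ℝ → ℝ) (F : Measure ℝ) (m : Fin n → ℝ)
    (S : Matrix (Fin n) (Fin n) ℝ) (ε : (Fin n → ℝ) → ℝ) (P : Set (Fin n → ℝ))
    (obj : (Fin n → ℝ) → ℝ) : Prop :=
  (∀ x ∈ P, IsGreatest (riskValues g F m S ε x) (obj x : EReal)) ∧
  (⨅ x ∈ P, worstCase g F m S ε x) = (⨅ x ∈ P, (obj x : EReal)) ∧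
  ∀ x ∈ P, IsMinOn (worstCase g F m S ε) P x ↔ IsMinOn obj P x

end RobustPortfolio

end

namespace RobustPortfolio

/-! Everything is transported to `L²(0,1)` by quantile functions. The carrying fact is the
rearrangement inequality `integral_mul_le_of_coupling`: among all couplings of two laws the
comonotone one maximises the expected product. Hence `wasserstein` is the `L²` distance of quantile
functions, and `distortionRisk g G` is the integral of `quantile G` against the weight γ
(`distortionRisk_eq_integral`).

The loss laws arising from the moment set are exactly the laws with mean `-μ_x` and variance `σ_x²`
(`lossLaw_moments`, `exists_mem_momentSet_lossLaw_eq`). Write `r` for the centred quantile function,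
`f` for that of `F`, and `k` for the standardised weight. Then `r ⟂ 1`, `‖r‖ = σ`, and expanding
`‖σf - r‖² ≤ 2σ²A` turns the Wasserstein constraint into `σ⟨r,f⟩ ≥ σ²(1-A)`. The excess of the risk
over `-μ_x` is `√V⟨r,k⟩`, and `⟨f,k⟩ = c₀`.

So a linear functional is maximised over a spherical cap around `f`. The cap is the point `σf` if `A
= 0`. It contains `σk` if `c₀ ≥ 1-A`. Otherwise the maximum lies on its boundary, in the plane of
`f` and `k`. A maximiser of the relaxed problem need not be known to be monotone: passing from a
function to the quantile function of its law can only raise the risk, because γ is non-decreasing,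
and leaves the constraint satisfied. -/

instance isProbabilityMeasure_unif : IsProbabilityMeasure unif :=
  ⟨by simp [unif]⟩

theorem ae_unif_mem : ∀ᵐ u ∂unif, u ∈ Ioo (0 : ℝ) 1 :=
  ae_restrict_mem measurableSet_Ioo

/-! ### Quantile functions -/

/-- For `0 < u < 1` the limits of the cdf make the defining set nonempty and bounded below, so
`sInf` is not a default value; right continuity puts the infimum in the set. -/
theorem quantile_le_iff (G : Measure ℝ) {u : ℝ} (hu : u ∈ Ioo (0 : ℝ) 1) (t : ℝ) :
    quantile G u ≤ t ↔ u ≤ cdf G t := by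
  obtain ⟨y₀, hy₀⟩ := ((tendsto_cdf_atBot G).eventually (gt_mem_nhds hu.1)).exists
  obtain ⟨y₁, hy₁⟩ := ((tendsto_cdf_atTop G).eventually (lt_mem_nhds hu.2)).exists
  have hbdd : BddBelow {y : ℝ | u ≤ cdf G y} := by
    refine ⟨y₀, fun y hy => ?_⟩
    by_contra! h
    exact absurd ((monotone_cdf G) h.le) (not_le.2 (hy₀.trans_le hy))
  have hnon : {y : ℝ | u ≤ cdf G y}.Nonempty := ⟨y₁, hy₁.le⟩
  refine ⟨fun h => ?_, fun h => csInf_le hbdd h⟩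
  have hright : ∀ s, t < s → u ≤ cdf G s := fun s hs => by
    obtain ⟨y, hy, hys⟩ := exists_lt_of_csInf_lt hnon (h.trans_lt hs)
    exact le_trans hy (monotone_cdf G hys.le)
  have hc : ContinuousWithinAt (cdf G) (Ioi t) t :=
    ((cdf G).right_continuous t).mono Ioi_subset_Ici_self
  exact ge_of_tendsto hc (Filter.eventually_of_mem self_mem_nhdsWithin hright)

theorem monotoneOn_quantile (G : Measure ℝ) : MonotoneOn (quantile G) (Ioo 0 1) := by
  intro u hu v hv huv
  rw [quantile_le_iff G hu]
  exact huv.trans ((quantile_le_iff G hv _).1 le_rfl)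

theorem aemeasurable_unif_of_monotoneOn {a : ℝ → ℝ} (ha : MonotoneOn a (Ioo 0 1)) :
    AEMeasurable a unif :=
  aemeasurable_restrict_of_monotoneOn measurableSet_Ioo ha

theorem aemeasurable_quantile (G : Measure ℝ) : AEMeasurable (quantile G) unif :=
  aemeasurable_unif_of_monotoneOn (monotoneOn_quantile G)

theorem unif_Iic {c : ℝ} (h1 : c ≤ 1) :
    unif (Iic c) = ENNReal.ofReal c := by
  rw [unif, Measure.restrict_apply measurableSet_Iic]
  have : (Iic c ∩ Ioo 0 1 : Set ℝ) =ᵐ[volume] Ioc 0 c := by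
    have h : (Iic c ∩ Ioo 0 1 : Set ℝ) =ᵐ[volume] (Iic c ∩ Ioc 0 1 : Set ℝ) :=
      (ae_eq_refl _).inter Ioo_ae_eq_Ioc
    refine h.trans (Filter.EventuallyEq.of_eq (Set.ext fun x => ?_))
    exact ⟨fun h => ⟨h.2.1, h.1⟩, fun h => ⟨h.2, h.1, h.2.trans h1⟩⟩
  rw [measure_congr this, Real.volume_Ioc, sub_zero]

theorem map_quantile (G : Measure ℝ) [IsProbabilityMeasure G] :
    unif.map (quantile G) = G := by
  have hq := aemeasurable_quantile G
  have : IsProbabilityMeasure (unif.map (quantile G)) := Measure.isProbabilityMeasure_map hq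
  refine Measure.ext_of_Iic _ _ fun t => ?_
  rw [Measure.map_apply_of_aemeasurable hq measurableSet_Iic, ← ofReal_cdf,
    ← unif_Iic (cdf_le_one G t)]
  refine measure_congr ?_
  filter_upwards [ae_unif_mem] with u hu
  exact propext (quantile_le_iff G hu t)

/-! ### Rearrangement -/

theorem lintegral_ofReal_eq_lintegral_meas_lt {Ω : Type*} [MeasurableSpace Ω] (P : Measure Ω)
    {f : Ω → ℝ} (hf : AEMeasurable f P) :
    ∫⁻ ω, ENNReal.ofReal (f ω) ∂P = ∫⁻ t in Ioi (0 : ℝ), P {ω | t < f ω} := by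
  have h := lintegral_eq_lintegral_meas_lt P (f := fun ω => max (f ω) 0)
    (Filter.Eventually.of_forall fun ω => le_max_right _ _) (hf.max aemeasurable_const)
  simp only [ENNReal.ofReal_max, ENNReal.ofReal_zero, max_eq_left zero_le] at h
  rw [h]
  refine setLIntegral_congr_fun measurableSet_Ioi fun t ht => ?_
  congr 1
  ext ω
  simp [not_lt.2 (mem_Ioi.1 ht).le]

theorem lintegral_ofReal_eq_lintegral_meas_le {Ω : Type*} [MeasurableSpace Ω] (P : Measure Ω)
    {f : Ω → ℝ} (hf : AEMeasurable f P) :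
    ∫⁻ ω, ENNReal.ofReal (f ω) ∂P = ∫⁻ t in Ioi (0 : ℝ), P {ω | t ≤ f ω} := by
  have h := lintegral_eq_lintegral_meas_le P (f := fun ω => max (f ω) 0)
    (Filter.Eventually.of_forall fun ω => le_max_right _ _) (hf.max aemeasurable_const)
  simp only [ENNReal.ofReal_max, ENNReal.ofReal_zero, max_eq_left zero_le] at h
  rw [h]
  refine setLIntegral_congr_fun measurableSet_Ioi fun t ht => ?_
  congr 1
  ext ω
  simp [not_le.2 (mem_Ioi.1 ht)]

/-- Layer cake applied twice: first to `f` under the measure with density `h⁺`, then to `h` on each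
level set of `f`. The product integral thus depends only on joint tail probabilities. -/
theorem lintegral_ofReal_mul_ofReal {Ω : Type*} [MeasurableSpace Ω] (P : Measure Ω)
    {f h : Ω → ℝ} (hf : AEMeasurable f P) (hh : AEMeasurable h P) :
    ∫⁻ ω, ENNReal.ofReal (f ω) * ENNReal.ofReal (h ω) ∂P =
      ∫⁻ s in Ioi (0 : ℝ), ∫⁻ t in Ioi (0 : ℝ), P ({ω | s < f ω} ∩ {ω | t < h ω}) := by
  have hac : P.withDensity (fun ω => ENNReal.ofReal (h ω)) ≪ P :=
    withDensity_absolutelyContinuous _ _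
  calc ∫⁻ ω, ENNReal.ofReal (f ω) * ENNReal.ofReal (h ω) ∂P
      = ∫⁻ ω, ENNReal.ofReal (f ω) ∂(P.withDensity fun ω => ENNReal.ofReal (h ω)) := by
        rw [lintegral_withDensity_eq_lintegral_mul₀ hh.ennreal_ofReal hf.ennreal_ofReal]
        exact lintegral_congr fun ω => mul_comm _ _
    _ = _ := by
        rw [lintegral_ofReal_eq_lintegral_meas_lt _ (hf.mono_ac hac)]
        refine setLIntegral_congr_fun measurableSet_Ioi fun s _ => ?_
        have hs : NullMeasurableSet {ω | s < f ω} P :=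
          nullMeasurableSet_lt aemeasurable_const hf
        rw [withDensity_apply₀ _ hs, lintegral_ofReal_eq_lintegral_meas_lt _ hh.restrict]
        refine setLIntegral_congr_fun measurableSet_Ioi fun t _ => ?_
        rw [Measure.restrict_apply₀' hs, inter_comm]

/-- Comonotonicity in set form: preimages of upper sets under monotone maps are upper sets in `D`,
and upper sets of a line are ordered by inclusion. -/
theorem preimage_nested_of_isUpperSet {a b : ℝ → ℝ} {D S T : Set ℝ} (ha : MonotoneOn a D)
    (hb : MonotoneOn b D) (hS : IsUpperSet S) (hT : IsUpperSet T) :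
    (∀ u ∈ D, a u ∈ S → b u ∈ T) ∨ ∀ u ∈ D, b u ∈ T → a u ∈ S := by
  by_contra! h
  obtain ⟨⟨u, hu, huS, huT⟩, v, hv, hvT, hvS⟩ := h
  rcases le_total u v with huv | hvu
  · exact hvS (hS (ha hu hv huv) huS)
  · exact huT (hT (hb hv hu hvu) hvT)

theorem preimage_nested_of_isLowerSet {a b : ℝ → ℝ} {D S T : Set ℝ} (ha : MonotoneOn a D)
    (hb : MonotoneOn b D) (hS : IsLowerSet S) (hT : IsLowerSet T) :
    (∀ u ∈ D, a u ∈ S → b u ∈ T) ∨ ∀ u ∈ D, b u ∈ T → a u ∈ S := by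
  by_contra! h
  obtain ⟨⟨u, hu, huS, huT⟩, v, hv, hvT, hvS⟩ := h
  rcases le_total u v with huv | hvu
  · exact huT (hT (hb hu hv huv) hvT)
  · exact hvS (hS (ha hv hu hvu) huS)

section Coupling

variable {a b : ℝ → ℝ} {π : Measure (ℝ × ℝ)}

/-- The Fréchet bound: a joint probability is at most either marginal one, and nested events attain
the smaller of the two. -/
theorem coupling_le_of_nested (ha : AEMeasurable a unif) (hb : AEMeasurable b unif)
    (h₁ : π.map Prod.fst = unif.map a) (h₂ : π.map Prod.snd = unif.map b) {S T : Set ℝ}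
    (hS : MeasurableSet S) (hT : MeasurableSet T)
    (h : (∀ u ∈ Ioo (0 : ℝ) 1, a u ∈ S → b u ∈ T) ∨ ∀ u ∈ Ioo (0 : ℝ) 1, b u ∈ T → a u ∈ S) :
    π (Prod.fst ⁻¹' S ∩ Prod.snd ⁻¹' T) ≤ unif (a ⁻¹' S ∩ b ⁻¹' T) := by
  rcases h with h | h
  · calc π (Prod.fst ⁻¹' S ∩ Prod.snd ⁻¹' T) ≤ π (Prod.fst ⁻¹' S) := measure_mono inter_subset_left
      _ = unif (a ⁻¹' S) := by
        rw [← Measure.map_apply measurable_fst hS, h₁, Measure.map_apply_of_aemeasurable ha hS]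
      _ ≤ _ := measure_mono_ae (by
        filter_upwards [ae_unif_mem] with u hu hS using ⟨hS, h u hu hS⟩)
  · calc π (Prod.fst ⁻¹' S ∩ Prod.snd ⁻¹' T) ≤ π (Prod.snd ⁻¹' T) := measure_mono inter_subset_right
      _ = unif (b ⁻¹' T) := by
        rw [← Measure.map_apply measurable_snd hT, h₂, Measure.map_apply_of_aemeasurable hb hT]
      _ ≤ _ := measure_mono_ae (by
        filter_upwards [ae_unif_mem] with u hu hT using ⟨h u hu hT, hT⟩)

theorem isProbabilityMeasure_coupling (ha : AEMeasurable a unif)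
    (h₁ : π.map Prod.fst = unif.map a) : IsProbabilityMeasure π := by
  have : IsProbabilityMeasure (π.map Prod.fst) := by
    rw [h₁]; exact Measure.isProbabilityMeasure_map ha
  exact Measure.isProbabilityMeasure_of_map Prod.fst

/-- Both measures give `T` the same mass, so the upper bound for `Sᶜ` with `T` is a lower bound for
`S` with `T`. -/
theorem le_coupling_of_nested_compl (ha : AEMeasurable a unif) (hb : AEMeasurable b unif)
    (h₁ : π.map Prod.fst = unif.map a) (h₂ : π.map Prod.snd = unif.map b) {S T : Set ℝ}
    (hS : MeasurableSet S) (hT : MeasurableSet T)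
    (h : (∀ u ∈ Ioo (0 : ℝ) 1, a u ∈ Sᶜ → b u ∈ T) ∨ ∀ u ∈ Ioo (0 : ℝ) 1, b u ∈ T → a u ∈ Sᶜ) :
    unif (a ⁻¹' S ∩ b ⁻¹' T) ≤ π (Prod.fst ⁻¹' S ∩ Prod.snd ⁻¹' T) := by
  have := isProbabilityMeasure_coupling ha h₁
  have hle := coupling_le_of_nested ha hb h₁ h₂ hS.compl hT h
  have e₁ : π (Prod.fst ⁻¹' S ∩ Prod.snd ⁻¹' T) + π (Prod.fst ⁻¹' Sᶜ ∩ Prod.snd ⁻¹' T) =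
      π (Prod.snd ⁻¹' T) := by
    rw [inter_comm, inter_comm (Prod.fst ⁻¹' Sᶜ)]
    exact measure_inter_add_sdiff _ (measurable_fst hS)
  have e₂ : unif (a ⁻¹' S ∩ b ⁻¹' T) + unif (a ⁻¹' Sᶜ ∩ b ⁻¹' T) = unif (b ⁻¹' T) := by
    rw [inter_comm, inter_comm (a ⁻¹' Sᶜ)]
    exact measure_inter_add_sdiff₀ _ (ha.nullMeasurableSet_preimage hS)
  have e₃ : π (Prod.snd ⁻¹' T) = unif (b ⁻¹' T) := by
    rw [← Measure.map_apply measurable_snd hT, h₂, Measure.map_apply_of_aemeasurable hb hT]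
  refine (ENNReal.add_le_add_iff_right (measure_ne_top unif (a ⁻¹' Sᶜ ∩ b ⁻¹' T))).1 ?_
  rw [e₂, ← e₃, ← e₁]
  gcongr

theorem ofReal_mul_eq_add (x y : ℝ) :
    ENNReal.ofReal (x * y) = ENNReal.ofReal x * ENNReal.ofReal y +
      ENNReal.ofReal (-x) * ENNReal.ofReal (-y) := by
  rcases le_total 0 x with hx | hx
  · rw [ENNReal.ofReal_mul hx, ENNReal.ofReal_of_nonpos (p := -x) (by linarith)]; simp
  · rw [← neg_mul_neg, ENNReal.ofReal_mul (by linarith), ENNReal.ofReal_of_nonpos hx]; simp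

/-- The positive part of a product lives on the quadrants where the signs agree, the negative part
on the other two. By layer cake and the Fréchet bounds, the comonotone pair has the largest positive
part and the smallest negative part. -/
theorem integral_mul_le_of_coupling (ha : MonotoneOn a (Ioo 0 1)) (hb : MonotoneOn b (Ioo 0 1))
    (ha2 : MemLp a 2 unif) (hb2 : MemLp b 2 unif)
    (h₁ : π.map Prod.fst = unif.map a) (h₂ : π.map Prod.snd = unif.map b) :
    Integrable (fun p : ℝ × ℝ => p.1 * p.2) π ∧
      ∫ p, p.1 * p.2 ∂π ≤ ∫ u, a u * b u ∂unif := by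
  have ham := aemeasurable_unif_of_monotoneOn ha
  have hbm := aemeasurable_unif_of_monotoneOn hb
  have ham' : AEMeasurable (fun u => -a u) unif := ham.neg
  have hbm' : AEMeasurable (fun u => -b u) unif := hbm.neg
  have m₁ : MemLp (fun p : ℝ × ℝ => p.1) 2 π := by
    have : MemLp (fun x : ℝ => x) 2 (π.map Prod.fst) := by
      rw [h₁]; exact (memLp_map_measure_iff (by fun_prop) ham).2 ha2
    exact (memLp_map_measure_iff (f := Prod.fst) (g := fun x : ℝ => x) (by fun_prop) (by fun_prop)).1 this
  have m₂ : MemLp (fun p : ℝ × ℝ => p.2) 2 π := by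
    have : MemLp (fun x : ℝ => x) 2 (π.map Prod.snd) := by
      rw [h₂]; exact (memLp_map_measure_iff (by fun_prop) hbm).2 hb2
    exact (memLp_map_measure_iff (f := Prod.snd) (g := fun x : ℝ => x) (by fun_prop) (by fun_prop)).1 this
  have hπ : Integrable (fun p : ℝ × ℝ => p.1 * p.2) π := m₁.integrable_mul m₂
  have hu : Integrable (fun u => a u * b u) unif := ha2.integrable_mul hb2
  refine ⟨hπ, ?_⟩
  have hpp : ∫⁻ p, ENNReal.ofReal (p.1 * p.2) ∂π ≤ ∫⁻ u, ENNReal.ofReal (a u * b u) ∂unif := by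
    simp only [ofReal_mul_eq_add]
    rw [lintegral_add_left (by fun_prop), lintegral_add_left' (by fun_prop),
      lintegral_ofReal_mul_ofReal π (by fun_prop) (by fun_prop),
      lintegral_ofReal_mul_ofReal π (by fun_prop) (by fun_prop),
      lintegral_ofReal_mul_ofReal unif ham hbm,
      lintegral_ofReal_mul_ofReal unif ham' hbm']
    refine add_le_add (lintegral_mono fun s => lintegral_mono fun t => ?_)
      (lintegral_mono fun s => lintegral_mono fun t => ?_)
    · exact coupling_le_of_nested ham hbm h₁ h₂ (S := Ioi s) (T := Ioi t) measurableSet_Ioi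
        measurableSet_Ioi (preimage_nested_of_isUpperSet ha hb (isUpperSet_Ioi s)
          (isUpperSet_Ioi t))
    · simp only [lt_neg (a := s), lt_neg (a := t)]
      exact coupling_le_of_nested ham hbm h₁ h₂ (S := Iio (-s)) (T := Iio (-t)) measurableSet_Iio
        measurableSet_Iio (preimage_nested_of_isLowerSet ha hb (isLowerSet_Iio _)
          (isLowerSet_Iio _))
  have hpn : ∫⁻ u, ENNReal.ofReal (-(a u * b u)) ∂unif ≤
      ∫⁻ p, ENNReal.ofReal (-(p.1 * p.2)) ∂π := by
    simp only [← mul_neg, ofReal_mul_eq_add, neg_neg]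
    rw [lintegral_add_left' (by fun_prop), lintegral_add_left (by fun_prop),
      lintegral_ofReal_mul_ofReal π (by fun_prop) (by fun_prop),
      lintegral_ofReal_mul_ofReal π (by fun_prop) (by fun_prop),
      lintegral_ofReal_mul_ofReal unif ham hbm',
      lintegral_ofReal_mul_ofReal unif ham' hbm]
    refine add_le_add (lintegral_mono fun s => lintegral_mono fun t => ?_)
      (lintegral_mono fun s => lintegral_mono fun t => ?_)
    · simp only [lt_neg (a := t)]
      refine le_coupling_of_nested_compl ham hbm h₁ h₂ (S := Ioi s) (T := Iio (-t))
        measurableSet_Ioi measurableSet_Iio ?_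
      rw [compl_Ioi]
      exact preimage_nested_of_isLowerSet ha hb (isLowerSet_Iic s) (isLowerSet_Iio _)
    · simp only [lt_neg (a := s)]
      refine le_coupling_of_nested_compl ham hbm h₁ h₂ (S := Iio (-s)) (T := Ioi t)
        measurableSet_Iio measurableSet_Ioi ?_
      rw [compl_Iio]
      exact preimage_nested_of_isUpperSet ha hb (isUpperSet_Ici _) (isUpperSet_Ioi _)
  rw [integral_eq_lintegral_pos_part_sub_lintegral_neg_part hπ,
    integral_eq_lintegral_pos_part_sub_lintegral_neg_part hu]
  exact sub_le_sub (ENNReal.toReal_mono hu.lintegral_lt_top.ne hpp)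
    (ENNReal.toReal_mono hπ.neg.lintegral_lt_top.ne hpn)

end Coupling

/-! ### The weight function -/

section Weight

variable {g : ℝ → ℝ}

theorem derivWithin_Iio_eq_derivWithin_Iic (f : ℝ → ℝ) (x : ℝ) :
    derivWithin f (Iio x) x = derivWithin f (Iic x) x := by
  refine derivWithin_congr_set' x ?_
  filter_upwards [self_mem_nhdsWithin] with y hy
  exact propext ⟨fun h => le_of_lt h, fun h => lt_of_le_of_ne h hy⟩

/-- Concavity makes the left derivative non-increasing, and the reflection `u ↦ 1 - u` reverses the
order. -/
theorem monotoneOn_weight (hconc : ConcaveOn ℝ (Icc 0 1) g) :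
    MonotoneOn (weight g) (Ioo 0 1) := by
  have h := hconc.neg.monotoneOn_leftDeriv
  rw [interior_Icc] at h
  intro u hu v hv huv
  have := h (a := 1 - v) ⟨by linarith [hv.2], by linarith [hv.1]⟩ (b := 1 - u)
    ⟨by linarith [hu.2], by linarith [hu.1]⟩ (by linarith)
  simp only [derivWithin.neg, derivWithin_Iio_eq_derivWithin_Iic] at this
  simpa [weight] using this

theorem weight_nonneg (hg : IsDistortion g) {u : ℝ} (hu : u ∈ Ioo (0 : ℝ) 1) :
    0 ≤ weight g u := by
  -- Monotonicity is known only on `[0,1]`; a derivative within a set depends only on the germ of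
  -- that set.
  have h : (Iic (1 - u) : Set ℝ) =ᶠ[nhds (1 - u)] Icc 0 (1 - u) := by
    filter_upwards [lt_mem_nhds (show (0 : ℝ) < 1 - u by linarith [hu.2])] with x hx
    exact propext ⟨fun h => ⟨hx.le, h⟩, fun h => h.2⟩
  rw [weight, derivWithin_congr_set h]
  exact (hg.monotoneOn.mono (Icc_subset_Icc_right (by linarith [hu.1]))).derivWithin_nonneg

theorem ae_weight_eq_deriv (hac : AbsolutelyContinuousOnInterval g 0 1) :
    ∀ᵐ u, u ∈ Icc (0 : ℝ) 1 → weight g u = deriv g (1 - u) := by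
  have h := (Measure.measurePreserving_sub_left volume (1 : ℝ)).quasiMeasurePreserving.ae
    hac.ae_differentiableAt
  filter_upwards [h] with u hu hu01
  have hd := hu (by rw [uIcc_of_le zero_le_one]; exact ⟨by linarith [hu01.2], by linarith [hu01.1]⟩)
  exact hd.derivWithin (uniqueDiffOn_Iic _ _ self_mem_Iic)

theorem integral_weight (hg : IsDistortion g) (hac : AbsolutelyContinuousOnInterval g 0 1)
    {v : ℝ} (h0 : 0 ≤ v) (h1 : v ≤ 1) :
    ∫ u in (0 : ℝ)..v, weight g u = 1 - g (1 - v) := by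
  have h : ∫ u in (0 : ℝ)..v, weight g u = ∫ u in (0 : ℝ)..v, deriv g (1 - u) := by
    refine intervalIntegral.integral_congr_ae ?_
    filter_upwards [ae_weight_eq_deriv hac] with u hu huv
    rw [uIoc_of_le h0] at huv
    exact hu ⟨huv.1.le, huv.2.trans h1⟩
  rw [h, intervalIntegral.integral_comp_sub_left (deriv g) 1, sub_zero,
    (hac.mono ?_).integral_deriv_eq_sub, hg.map_one]
  rw [uIcc_of_le zero_le_one, uIcc_of_le (by linarith)]
  exact Icc_subset_Icc_left (by linarith)

theorem setIntegral_unif_Iic (f : ℝ → ℝ) {v : ℝ} (h0 : 0 ≤ v) (h1 : v ≤ 1) :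
    ∫ u in Iic v, f u ∂unif = ∫ u in (0 : ℝ)..v, f u := by
  rw [unif, Measure.restrict_restrict measurableSet_Iic, intervalIntegral.integral_of_le h0]
  refine setIntegral_congr_set ?_
  have h : (Iic v ∩ Ioo 0 1 : Set ℝ) =ᵐ[volume] (Iic v ∩ Ioc 0 1 : Set ℝ) :=
    (ae_eq_refl _).inter Ioo_ae_eq_Ioc
  refine h.trans (Filter.EventuallyEq.of_eq (Set.ext fun x => ?_))
  exact ⟨fun h => ⟨h.2.1, h.1⟩, fun h => ⟨h.2, h.1, h.2.trans h1⟩⟩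

theorem integral_weight_unif (hg : IsDistortion g)
    (hac : AbsolutelyContinuousOnInterval g 0 1) : ∫ u, weight g u ∂unif = 1 := by
  have h := setIntegral_unif_Iic (weight g) zero_le_one le_rfl
  rw [integral_weight hg hac zero_le_one le_rfl, sub_self, hg.map_zero, sub_zero] at h
  rw [← h]
  refine (setIntegral_eq_integral_of_ae_compl_eq_zero ?_).symm
  filter_upwards [ae_unif_mem] with u hu hu'
  exact absurd hu.2.le hu'

/-- The distortion `g` as a change of measure on the unit interval. -/
noncomputable def weightMeasure (g : ℝ → ℝ) : Measure ℝ :=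
  unif.withDensity fun u => ENNReal.ofReal (weight g u)

theorem weightMeasure_Iic (hg : IsDistortion g) (hac : AbsolutelyContinuousOnInterval g 0 1)
    (hint : Integrable (weight g) unif) {v : ℝ} (h0 : 0 ≤ v) (h1 : v ≤ 1) :
    weightMeasure g (Iic v) = ENNReal.ofReal (1 - g (1 - v)) := by
  rw [weightMeasure, withDensity_apply _ measurableSet_Iic, ← integral_weight hg hac h0 h1,
    ← setIntegral_unif_Iic (weight g) h0 h1, ofReal_integral_eq_lintegral_ofReal hint.restrict]
  exact ae_restrict_of_ae (ae_unif_mem.mono fun u hu => weight_nonneg hg hu)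

theorem weightMeasure_univ (hg : IsDistortion g) (hac : AbsolutelyContinuousOnInterval g 0 1)
    (hint : Integrable (weight g) unif) : weightMeasure g univ = 1 := by
  rw [weightMeasure, withDensity_apply _ MeasurableSet.univ, Measure.restrict_univ,
    ← ofReal_integral_eq_lintegral_ofReal hint
      (ae_unif_mem.mono fun u hu => weight_nonneg hg hu), integral_weight_unif hg hac,
    ENNReal.ofReal_one]

theorem weightMeasure_Ioi (hg : IsDistortion g) (hac : AbsolutelyContinuousOnInterval g 0 1)
    (hint : Integrable (weight g) unif) {v : ℝ} (h0 : 0 ≤ v) (h1 : v ≤ 1) :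
    weightMeasure g (Ioi v) = ENNReal.ofReal (g (1 - v)) := by
  have hle : g (1 - v) ≤ 1 := by
    refine (hg.monotoneOn ⟨?_, ?_⟩ ⟨zero_le_one, le_rfl⟩ ?_).trans_eq hg.map_one <;> linarith
  rw [← compl_Iic, measure_compl measurableSet_Iic, weightMeasure_univ hg hac hint,
    weightMeasure_Iic hg hac hint h0 h1, ← ENNReal.ofReal_one, ← ENNReal.ofReal_sub _ (by linarith),
    sub_sub_cancel]
  rw [weightMeasure_Iic hg hac hint h0 h1]
  exact ENNReal.ofReal_ne_top

/-- The quantile representation of a distortion risk measure. -/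
theorem distortionRisk_eq_integral (hg : IsDistortion g)
    (hac : AbsolutelyContinuousOnInterval g 0 1) (hsq : MemLp (weight g) 2 unif)
    (G : Measure ℝ) (hq : MemLp (quantile G) 2 unif) :
    distortionRisk g G = ((∫ u, quantile G u * weight g u ∂unif : ℝ) : EReal) := by
  have hint : Integrable (weight g) unif := hsq.integrable one_le_two
  have hqw : Integrable (fun u => quantile G u * weight g u) unif := hq.integrable_mul hsq
  have hqm := aemeasurable_quantile G
  have hac' : weightMeasure g ≪ unif := withDensity_absolutelyContinuous _ _
  have hqm' : AEMeasurable (quantile G) (weightMeasure g) := hqm.mono_ac hac'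
  have hmul : ∀ f : ℝ → ℝ, AEMeasurable f unif →
      ∫⁻ u, ENNReal.ofReal (f u * weight g u) ∂unif =
        ∫⁻ u, ENNReal.ofReal (f u) ∂weightMeasure g := fun f hf => by
    rw [weightMeasure, lintegral_withDensity_eq_lintegral_mul₀
      hint.aemeasurable.ennreal_ofReal hf.ennreal_ofReal]
    refine lintegral_congr_ae ?_
    filter_upwards [ae_unif_mem] with u hu
    rw [ENNReal.ofReal_mul' (weight_nonneg hg hu), mul_comm]
    rfl
  have hpos : ∫⁻ u, ENNReal.ofReal (quantile G u * weight g u) ∂unif =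
      ∫⁻ x in Ioi (0 : ℝ), ENNReal.ofReal (g (1 - cdf G x)) := by
    rw [hmul _ hqm, lintegral_ofReal_eq_lintegral_meas_lt _ hqm']
    refine lintegral_congr fun t => ?_
    rw [← weightMeasure_Ioi hg hac hint (cdf_nonneg G t) (cdf_le_one G t)]
    refine measure_congr ?_
    filter_upwards [hac'.ae_le ae_unif_mem] with u hu
    refine propext (?_ : t < quantile G u ↔ cdf G t < u)
    rw [← not_le, ← not_le, quantile_le_iff G hu]
  have hneg : ∫⁻ u, ENNReal.ofReal (-(quantile G u * weight g u)) ∂unif =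
      ∫⁻ x in Iic (0 : ℝ), ENNReal.ofReal (1 - g (1 - cdf G x)) := by
    simp only [← neg_mul]
    have hqn : AEMeasurable (fun u => -quantile G u) unif := hqm.neg
    -- The non-strict layer cake is used because `t ≤ -quantile G u` is exactly `u ≤ cdf G (-t)`.
    -- The reflection `t ↦ -t` then carries the half-line integral to the negative axis.
    rw [hmul _ hqn, lintegral_ofReal_eq_lintegral_meas_le _ (hqn.mono_ac hac'),
      setLIntegral_congr Iio_ae_eq_Iic.symm, ← (Measure.measurePreserving_neg
        (volume : Measure ℝ)).setLIntegral_comp_preimage_emb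
        (MeasurableEquiv.neg ℝ).measurableEmbedding _ (Iio 0)]
    have : (Neg.neg ⁻¹' Iio (0 : ℝ)) = Ioi 0 := by ext x; simp
    rw [this]
    refine lintegral_congr fun t => ?_
    rw [← weightMeasure_Iic hg hac hint (cdf_nonneg G (-t)) (cdf_le_one G (-t))]
    refine measure_congr ?_
    filter_upwards [hac'.ae_le ae_unif_mem] with u hu
    refine propext (?_ : t ≤ -quantile G u ↔ u ≤ cdf G (-t))
    rw [← quantile_le_iff G hu, le_neg]
  rw [distortionRisk, ← hpos, ← hneg,
    integral_eq_lintegral_pos_part_sub_lintegral_neg_part hqw, EReal.coe_sub,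
    EReal.coe_ennreal_toReal, EReal.coe_ennreal_toReal]
  · exact hqw.neg.lintegral_lt_top.ne
  · exact hqw.lintegral_lt_top.ne

end Weight

/-! ### Portfolio losses -/

section Portfolio

variable {n : ℕ} {S : Matrix (Fin n) (Fin n) ℝ}

theorem portStd_sq (hS : S.PosSemidef) (x : Fin n → ℝ) :
    portStd S x ^ 2 = x ⬝ᵥ (S *ᵥ x) :=
  Real.sq_sqrt (by simpa using hS.dotProduct_mulVec_nonneg x)

theorem covariance_dotProduct {Ω : Type*} [MeasurableSpace Ω] {Q : Measure Ω} [IsFiniteMeasure Q]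
    {W : Fin n → Ω → ℝ} (hW : ∀ i, MemLp (W i) 2 Q) (hcov : ∀ i j, cov[W i, W j; Q] = S i j)
    (x : Fin n → ℝ) (i : Fin n) :
    cov[W i, fun ω => ∑ j, x j * W j ω; Q] = (S *ᵥ x) i := by
  rw [covariance_fun_sum_right (fun j => (hW j).const_mul (x j)) (hW i)]
  simp only [covariance_const_mul_right, hcov, Matrix.mulVec, dotProduct]
  exact Finset.sum_congr rfl fun j _ => mul_comm _ _

theorem covariance_dotProduct_self {Ω : Type*} [MeasurableSpace Ω] {Q : Measure Ω}
    [IsFiniteMeasure Q] {W : Fin n → Ω → ℝ} (hW : ∀ i, MemLp (W i) 2 Q)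
    (hcov : ∀ i j, cov[W i, W j; Q] = S i j) (x : Fin n → ℝ) :
    cov[fun ω => ∑ j, x j * W j ω, fun ω => ∑ j, x j * W j ω; Q] = x ⬝ᵥ (S *ᵥ x) := by
  rw [covariance_fun_sum_left (fun j => (hW j).const_mul (x j))
    (memLp_finsetSum _ fun j _ => (hW j).const_mul (x j))]
  simp [covariance_const_mul_left, covariance_dotProduct hW hcov, dotProduct]

theorem lossLaw_moments (hS : S.PosSemidef) {m : Fin n → ℝ} {G : Measure (Fin n → ℝ)}
    (hG : G ∈ momentSet m S) (x : Fin n → ℝ) :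
    IsProbabilityMeasure (lossLaw G x) ∧ MemLp (fun z : ℝ => z) 2 (lossLaw G x) ∧
      ∫ z, z ∂lossLaw G x = -portMean m x ∧
      Var[fun z : ℝ => z; lossLaw G x] = portStd S x ^ 2 := by
  obtain ⟨hp, hL, hm, hc⟩ := hG
  have hmeas : Measurable fun r : Fin n → ℝ => -(x ⬝ᵥ r) := by
    unfold dotProduct; fun_prop
  have hsum : MemLp (fun r : Fin n → ℝ => ∑ j, x j * r j) 2 G :=
    memLp_finsetSum _ fun j _ => (hL j).const_mul (x j)
  refine ⟨Measure.isProbabilityMeasure_map hmeas.aemeasurable, ?_, ?_, ?_⟩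
  · rw [lossLaw, memLp_map_measure_iff (by fun_prop) hmeas.aemeasurable]
    exact hsum.neg
  · rw [lossLaw, integral_map hmeas.aemeasurable (by fun_prop), integral_neg]
    simp only [dotProduct, portMean]
    rw [integral_finsetSum _ fun j _ => ((hL j).const_mul (x j)).integrable one_le_two]
    simp [integral_const_mul, hm]
  · rw [lossLaw, variance_map (by fun_prop) hmeas.aemeasurable, portStd_sq hS,
      ← covariance_dotProduct_self hL hc x, covariance_self hsum.aemeasurable]
    exact variance_fun_neg

/-- Take `W` centred Gaussian with covariance `S` and, independently, `Y` with the law of the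
centred target loss. With `X = xᵀW`, `Z = X + Y` and `v = Sx/σ²`, the vector `R = m + W - vZ`
replaces the component `X` of `xᵀR` by `-Y`, so the loss is `-μ_x + Y`. Since `cov(W, Z) = Sx` and
`var Z = 2σ²`, the correction terms cancel and the covariance stays `S`. -/
theorem exists_mem_momentSet_lossLaw_eq (hS : S.PosSemidef) (m x : Fin n → ℝ) (L : Measure ℝ)
    [IsProbabilityMeasure L] (hL : MemLp (fun z : ℝ => z) 2 L)
    (hmean : ∫ z, z ∂L = -portMean m x) (hvar : Var[fun z : ℝ => z; L] = portStd S x ^ 2) :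
    ∃ G ∈ momentSet m S, lossLaw G x = L := by
  set N : Measure (EuclideanSpace ℝ (Fin n)) := multivariateGaussian 0 S with hN
  set Q := N.prod L with hQ
  set σ := portStd S x with hσ
  set v : Fin n → ℝ := fun i => (S *ᵥ x) i / σ ^ 2 with hv
  set W : Fin n → EuclideanSpace ℝ (Fin n) × ℝ → ℝ := fun i ω => ω.1 i with hWdef
  set Y : EuclideanSpace ℝ (Fin n) × ℝ → ℝ := fun ω => ω.2 + portMean m x with hYdef
  set X : EuclideanSpace ℝ (Fin n) × ℝ → ℝ := fun ω => ∑ j, x j * W j ω with hXdef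
  set Z : EuclideanSpace ℝ (Fin n) × ℝ → ℝ := fun ω => X ω + Y ω with hZdef
  set R : EuclideanSpace ℝ (Fin n) × ℝ → Fin n → ℝ := fun ω i => m i + (W i ω - v i * Z ω)
    with hRdef
  have hNi : ∀ i, MemLp (fun w : EuclideanSpace ℝ (Fin n) => w i) 2 N := fun i =>
    IsGaussian.memLp_dual N (EuclideanSpace.proj i) 2 (by simp)
  have hWL : ∀ i, MemLp (W i) 2 Q := fun i => (hNi i).comp_fst L
  have hLY : MemLp (fun z : ℝ => z + portMean m x) 2 L := hL.add (memLp_const _)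
  have hYL : MemLp Y 2 Q := hLY.comp_snd N
  have hXL : MemLp X 2 Q := memLp_finsetSum _ fun j _ => (hWL j).const_mul (x j)
  have hZL : MemLp Z 2 Q := hXL.add hYL
  have hW0 : ∀ i, ∫ ω, W i ω ∂Q = 0 := fun i => by
    rw [hQ, integral_fun_fst (fun w : EuclideanSpace ℝ (Fin n) => w i)]
    have : ∫ w, w i ∂N = (∫ w, w ∂N) i :=
      (EuclideanSpace.proj (𝕜 := ℝ) i).integral_comp_comm
        ((IsGaussian.memLp_id N 1 (by simp)).integrable le_rfl)
    rw [this, integral_id_multivariateGaussian]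
    simp
  have hY0 : ∫ ω, Y ω ∂Q = 0 := by
    rw [hQ, integral_fun_snd (fun z : ℝ => z + portMean m x),
      integral_add (hL.integrable one_le_two) (integrable_const _), hmean]
    simp
  have hX0 : ∫ ω, X ω ∂Q = 0 := by
    simp only [hXdef]
    rw [integral_finsetSum _ fun j _ => ((hWL j).const_mul (x j)).integrable one_le_two]
    simp [integral_const_mul, hW0]
  have hZ0 : ∫ ω, Z ω ∂Q = 0 := by
    rw [integral_add (hXL.integrable one_le_two) (hYL.integrable one_le_two), hX0, hY0, add_zero]
  have hcW : ∀ i j, cov[W i, W j; Q] = S i j := fun i j => by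
    rw [← covariance_eval_multivariateGaussian (μ := 0) hS i j, ← hN,
      ← (measurePreserving_fst (μ := N) (ν := L)).map_eq, covariance_map_fun]
    all_goals fun_prop
  have hcWY : ∀ i, cov[W i, Y; Q] = 0 := fun i => covariance_fst_snd_prod (hNi i) hLY
  have hcXY : cov[X, Y; Q] = 0 := by
    rw [hXdef, covariance_fun_sum_left (fun j => (hWL j).const_mul (x j)) hYL]
    simp [covariance_const_mul_left, hcWY]
  have hcYY : cov[Y, Y; Q] = σ ^ 2 := by
    rw [covariance_self hYL.aemeasurable, ← hvar,
      ← variance_add_const hL.aestronglyMeasurable (portMean m x),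
      ← (measurePreserving_snd (μ := N) (ν := L)).map_eq, variance_map]
    · rfl
    all_goals fun_prop
  have hcXX : cov[X, X; Q] = σ ^ 2 := by
    rw [hσ, portStd_sq hS, ← covariance_dotProduct_self hWL hcW x]
  have hcWZ : ∀ i, cov[W i, Z; Q] = (S *ᵥ x) i := fun i => by
    refine (covariance_add_right (hWL i) hXL hYL).trans ?_
    rw [hcWY, covariance_dotProduct hWL hcW, add_zero]
  have hcZZ : cov[Z, Z; Q] = 2 * σ ^ 2 := by
    have hZ : Z = X + Y := rfl
    rw [hZ, covariance_add_left hXL hYL (hXL.add hYL), covariance_add_right hXL hXL hYL,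
      covariance_add_right hYL hXL hYL, hcXX, hcXY, covariance_comm Y X, hcXY, hcYY]
    ring
  have hRm : Measurable R := by
    refine measurable_pi_lambda _ fun i => ?_
    simp only [hRdef, hZdef, hXdef, hYdef, hWdef]
    fun_prop
  have hRL : ∀ i, MemLp (fun ω => R ω i) 2 Q := fun i =>
    (memLp_const (m i)).add ((hWL i).sub (hZL.const_mul (v i)))
  refine ⟨Q.map R, ⟨Measure.isProbabilityMeasure_map hRm.aemeasurable, fun i => ?_, fun i => ?_,
    fun i j => ?_⟩, ?_⟩
  · rw [memLp_map_measure_iff (measurable_pi_apply i).aestronglyMeasurable hRm.aemeasurable]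
    exact hRL i
  · rw [integral_map hRm.aemeasurable (measurable_pi_apply i).aestronglyMeasurable]
    refine (integral_add (integrable_const _)
      (((hWL i).sub (hZL.const_mul (v i))).integrable one_le_two)).trans ?_
    simp only [Pi.sub_apply]
    rw [integral_sub ((hWL i).integrable one_le_two) ((hZL.const_mul (v i)).integrable one_le_two),
      integral_const_mul, hW0, hZ0]
    simp
  · rw [covariance_map_fun (measurable_pi_apply i).aestronglyMeasurable
      (measurable_pi_apply j).aestronglyMeasurable hRm.aemeasurable]
    have hVL : ∀ i, MemLp (fun ω => v i * Z ω) 2 Q := fun i => hZL.const_mul (v i)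
    have hDL : ∀ i, MemLp (fun ω => W i ω - v i * Z ω) 2 Q := fun i => (hWL i).sub (hVL i)
    simp only [hRdef]
    rw [covariance_const_add_left ((hDL i).integrable one_le_two),
      covariance_const_add_right ((hDL j).integrable one_le_two),
      covariance_fun_sub_fun_sub (hWL i) (hVL i) (hWL j) (hVL j), covariance_const_mul_left,
      covariance_const_mul_right, covariance_const_mul_left, covariance_const_mul_right,
      covariance_comm Z (W j), hcWZ, hcWZ, hcZZ, hcW]
    simp only [hv]
    -- If `σ = 0`, division by zero gives `v = 0`, so `R = m + W`.
    by_cases h0 : σ ^ 2 = 0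
    · simp [h0]
    · field_simp
      ring
  · have hmeas : Measurable fun r : Fin n → ℝ => -(x ⬝ᵥ r) := by
      unfold dotProduct; fun_prop
    rw [lossLaw, Measure.map_map hmeas hRm]
    refine Eq.trans (Measure.map_congr ?_) (measurePreserving_snd (μ := N) (ν := L)).map_eq
    have key : ∀ ω, -(x ⬝ᵥ R ω) = -portMean m x - X ω + (x ⬝ᵥ v) * (X ω + Y ω) := fun ω => by
      simp only [dotProduct, portMean, hRdef, hXdef, hZdef, mul_add, mul_sub,
        Finset.sum_add_distrib, Finset.sum_sub_distrib, Finset.sum_mul]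
      simp only [← mul_assoc, ← Finset.sum_mul]
      ring
    have hxv : x ⬝ᵥ v = σ ^ 2 / σ ^ 2 := by
      nth_rewrite 1 [hσ, portStd_sq hS]
      simp only [hv, dotProduct, Finset.sum_div, mul_div_assoc]
    -- If `σ = 0`, both `X` and `Y` have variance zero and vanish almost surely.
    by_cases h0 : σ ^ 2 = 0
    · have hX : X =ᵐ[Q] fun _ => 0 := by
        have := ae_eq_integral_of_variance_eq_zero hXL
          (by rw [← covariance_self hXL.aemeasurable, hcXX, h0])
        rwa [hX0] at this
      have hY : Y =ᵐ[Q] fun _ => 0 := by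
        have := ae_eq_integral_of_variance_eq_zero hYL
          (by rw [← covariance_self hYL.aemeasurable, hcYY, h0])
        rwa [hY0] at this
      filter_upwards [hX, hY] with ω h1 h2
      simp only [Function.comp_apply, key, hxv, h0, h1]
      simp only [hYdef] at h2
      linarith
    · refine Filter.Eventually.of_forall fun ω => ?_
      simp only [Function.comp_apply, key, hxv, div_self h0, hYdef]
      ring

end Portfolio

/-! ### The Wasserstein distance through quantile functions -/

section Wasserstein

variable {p q : ℝ → ℝ}

theorem map_prodMk_fst (hp : AEMeasurable p unif) (hq : AEMeasurable q unif) :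
    (unif.map fun u => (p u, q u)).map Prod.fst = unif.map p :=
  AEMeasurable.map_map_of_aemeasurable (by fun_prop) (hp.prodMk hq)

theorem map_prodMk_snd (hp : AEMeasurable p unif) (hq : AEMeasurable q unif) :
    (unif.map fun u => (p u, q u)).map Prod.snd = unif.map q :=
  AEMeasurable.map_map_of_aemeasurable (by fun_prop) (hp.prodMk hq)

theorem ofReal_rpow_half {c : ℝ} (hc : 0 ≤ c) :
    ENNReal.ofReal c ^ (1 / 2 : ℝ) = ENNReal.ofReal (√c) := by
  rw [ENNReal.ofReal_rpow_of_nonneg hc (by norm_num), Real.sqrt_eq_rpow]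

/-- The pair `(p, q)` is itself a coupling; no monotonicity is needed on this side. -/
theorem wasserstein_map_le (hp : MemLp p 2 unif) (hq : MemLp q 2 unif) :
    wasserstein (unif.map p) (unif.map q) ≤ ENNReal.ofReal (√(∫ u, (p u - q u) ^ 2 ∂unif)) := by
  have hpm := hp.aemeasurable
  have hqm := hq.aemeasurable
  refine iInf₂_le_of_le (unif.map fun u => (p u, q u))
    ⟨map_prodMk_fst hpm hqm, map_prodMk_snd hpm hqm⟩ (le_of_eq ?_)
  have hi : Integrable (fun u => (p u - q u) ^ 2) unif := (hp.sub hq).integrable_sq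
  rw [lintegral_map' (by fun_prop) (hpm.prodMk hqm), ← ofReal_rpow_half
    (integral_nonneg fun u => sq_nonneg _), ofReal_integral_eq_lintegral_ofReal hi
    (Filter.Eventually.of_forall fun u => sq_nonneg _)]

/-- The second moments are fixed by the marginals, so only the cross term varies with the coupling,
and rearrangement bounds it. -/
theorem le_wasserstein_map (hpmono : MonotoneOn p (Ioo 0 1)) (hqmono : MonotoneOn q (Ioo 0 1))
    (hp : MemLp p 2 unif) (hq : MemLp q 2 unif) :
    ENNReal.ofReal (√(∫ u, (p u - q u) ^ 2 ∂unif)) ≤ wasserstein (unif.map p) (unif.map q) := by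
  have hpm := hp.aemeasurable
  have hqm := hq.aemeasurable
  refine le_iInf₂ fun π hπ => ?_
  obtain ⟨h₁, h₂⟩ := hπ
  obtain ⟨hint, hle⟩ := integral_mul_le_of_coupling hpmono hqmono hp hq h₁ h₂
  have sq_marginal : ∀ {φ : ℝ × ℝ → ℝ} {a : ℝ → ℝ}, Measurable φ → MemLp a 2 unif →
      π.map φ = unif.map a → Integrable (fun z => φ z ^ 2) π ∧
        ∫ z, φ z ^ 2 ∂π = ∫ u, a u ^ 2 ∂unif := fun {φ a} hφ ha h => by
    have hm : AEStronglyMeasurable (fun x : ℝ => x ^ 2) (unif.map a) := by fun_prop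
    have hm' : AEStronglyMeasurable (fun x : ℝ => x ^ 2) (π.map φ) := by fun_prop
    have e₁ : ∫ x, x ^ 2 ∂π.map φ = ∫ z, φ z ^ 2 ∂π := integral_map hφ.aemeasurable hm'
    have e₂ : ∫ x, x ^ 2 ∂unif.map a = ∫ u, a u ^ 2 ∂unif := integral_map ha.aemeasurable hm
    refine ⟨(integrable_map_measure hm' hφ.aemeasurable).1 ?_, ?_⟩
    · rw [h]
      exact (integrable_map_measure hm ha.aemeasurable).2 ha.integrable_sq
    · rw [← e₁, ← e₂, h]
  obtain ⟨i₁, e₁⟩ := sq_marginal measurable_fst hp h₁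
  obtain ⟨i₂, e₂⟩ := sq_marginal measurable_snd hq h₂
  have hpq : Integrable (fun u => p u * q u) unif := hp.integrable_mul hq
  have expand : ∀ x y : ℝ, (x - y) ^ 2 = x ^ 2 + y ^ 2 - 2 * (x * y) := fun x y => by ring
  have i₁₂ : Integrable (fun z : ℝ × ℝ => z.1 ^ 2 + z.2 ^ 2) π := i₁.add i₂
  have hiπ : Integrable (fun z : ℝ × ℝ => (z.1 - z.2) ^ 2) π := by
    simp only [expand]
    exact i₁₂.sub (hint.const_mul 2)
  have ipq : Integrable (fun u => p u ^ 2 + q u ^ 2) unif :=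
    hp.integrable_sq.add hq.integrable_sq
  have hu : ∫ u, (p u - q u) ^ 2 ∂unif =
      ∫ u, p u ^ 2 ∂unif + ∫ u, q u ^ 2 ∂unif - 2 * ∫ u, p u * q u ∂unif := by
    simp only [expand]
    rw [integral_sub ipq (hpq.const_mul 2),
      integral_add hp.integrable_sq hq.integrable_sq, integral_const_mul]
  have hπ : ∫ z, (z.1 - z.2) ^ 2 ∂π =
      ∫ z, z.1 ^ 2 ∂π + ∫ z, z.2 ^ 2 ∂π - 2 * ∫ z, z.1 * z.2 ∂π := by
    simp only [expand]
    rw [integral_sub i₁₂ (hint.const_mul 2), integral_add i₁ i₂, integral_const_mul]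
  rw [← ofReal_rpow_half (integral_nonneg fun u => sq_nonneg _),
    ← ofReal_integral_eq_lintegral_ofReal hiπ (Filter.Eventually.of_forall fun u => sq_nonneg _)]
  refine ENNReal.rpow_le_rpow (ENNReal.ofReal_le_ofReal ?_) (by norm_num)
  rw [hu, hπ, e₁, e₂]
  linarith

end Wasserstein

/-! ### Square integrable functions on the unit interval -/

theorem inner_toLp_toLp {f h : ℝ → ℝ} (hf : MemLp f 2 unif) (hh : MemLp h 2 unif) :
    inner ℝ (hf.toLp f) (hh.toLp h) = ∫ u, f u * h u ∂unif := by
  rw [L2.inner_def]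
  refine integral_congr_ae ?_
  filter_upwards [hf.coeFn_toLp, hh.coeFn_toLp] with u h1 h2
  simp [h1, h2, mul_comm]

theorem integral_sq_eq_norm_sq {f : ℝ → ℝ} (hf : MemLp f 2 unif) :
    ∫ u, f u ^ 2 ∂unif = ‖hf.toLp f‖ ^ 2 := by
  rw [← real_inner_self_eq_norm_sq, inner_toLp_toLp]
  simp only [sq]

/-- The constant function `1` in `L²(0,1)`. -/
noncomputable def oneLp : Lp ℝ 2 unif := (memLp_const (1 : ℝ)).toLp _

theorem inner_toLp_oneLp {f : ℝ → ℝ} (hf : MemLp f 2 unif) :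
    inner ℝ (hf.toLp f) oneLp = ∫ u, f u ∂unif := by
  rw [oneLp, inner_toLp_toLp]
  simp

theorem memLp_quantile {G : Measure ℝ} [IsProbabilityMeasure G]
    (hG : MemLp (fun z : ℝ => z) 2 G) : MemLp (quantile G) 2 unif := by
  rw [← map_quantile G] at hG
  exact (memLp_map_measure_iff (by fun_prop) (aemeasurable_quantile G)).1 hG

theorem integral_quantile (G : Measure ℝ) [IsProbabilityMeasure G] :
    ∫ u, quantile G u ∂unif = ∫ z, z ∂G := by
  conv_rhs => rw [← map_quantile G, integral_map (aemeasurable_quantile G) (by fun_prop)]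

theorem variance_quantile (G : Measure ℝ) [IsProbabilityMeasure G] :
    Var[quantile G; unif] = Var[fun z : ℝ => z; G] := by
  conv_rhs => rw [← map_quantile G, variance_map (by fun_prop) (aemeasurable_quantile G)]
  rfl

theorem quantile_moments {G : Measure ℝ} [IsProbabilityMeasure G]
    {c s : ℝ} (hmean : ∫ z, z ∂G = c)
    (hvar : Var[fun z : ℝ => z; G] = s) :
    ∫ u, (quantile G u - c) ^ 2 ∂unif = s := by
  rw [← hvar, ← variance_quantile, variance_eq_integral (aemeasurable_quantile G),
    integral_quantile, hmean]

/-! ### The inner maximisation -/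

section InnerMax

variable {n : ℕ} {g : ℝ → ℝ} {F : Measure ℝ} [IsProbabilityMeasure F] {m : Fin n → ℝ}
  {S : Matrix (Fin n) (Fin n) ℝ} {ε : (Fin n → ℝ) → ℝ} {x : Fin n → ℝ} {b w : ℝ}

theorem benchmark_eq_map (F : Measure ℝ) [IsProbabilityMeasure F] (m : Fin n → ℝ)
    (S : Matrix (Fin n) (Fin n) ℝ) (x : Fin n → ℝ) :
    benchmark F m S x = unif.map fun u => -portMean m x + portStd S x * quantile F u := by
  conv_lhs => rw [benchmark, ← map_quantile F]
  exact AEMeasurable.map_map_of_aemeasurable (by fun_prop) (aemeasurable_quantile F)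

/-- Here `b` plays the role of `1 - A`. The cap condition in `hup` is not divided by `σ`, so that `σ
= 0` is covered as well. -/
theorem distortionRisk_lossLaw_le (hg : IsDistortion g)
    (hac : AbsolutelyContinuousOnInterval g 0 1) (hsq : MemLp (weight g) 2 unif)
    (hf : MemLp (quantile F) 2 unif) (hf1 : ‖hf.toLp‖ = 1) (hS : S.PosSemidef)
    (hε : ε x = 2 * portStd S x ^ 2 * (1 - b)) (hb : b ≤ 1)
    (hup : ∀ r : Lp ℝ 2 unif, inner ℝ r oneLp = 0 → ‖r‖ = portStd S x →
      portStd S x ^ 2 * b ≤ portStd S x * inner ℝ r hf.toLp → inner ℝ r hsq.toLp ≤ w)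
    {G : Measure (Fin n → ℝ)} (hG : G ∈ feasible F m S ε x) :
    distortionRisk g (lossLaw G x) ≤ ((-portMean m x + w : ℝ) : EReal) := by
  obtain ⟨hGm, hGW⟩ := hG
  obtain ⟨hLp, hL2, hLmean, hLvar⟩ := lossLaw_moments hS hGm x
  set L := lossLaw G x with hLdef
  set σ := portStd S x with hσ
  have hσ0 : 0 ≤ σ := Real.sqrt_nonneg _
  set a := -portMean m x with ha
  have hq : MemLp (quantile L) 2 unif := memLp_quantile hL2
  have hr : MemLp (fun u => quantile L u - a) 2 unif := hq.sub (memLp_const a)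
  have hfa : MemLp (fun u => a + σ * quantile F u) 2 unif :=
    (memLp_const a).add (hf.const_mul σ)
  have hr0 : ∫ u, (quantile L u - a) ∂unif = 0 := by
    rw [integral_sub (hq.integrable one_le_two) (integrable_const a), integral_quantile, hLmean]
    simp
  have hrn : ‖hr.toLp‖ = σ := by
    have h := integral_sq_eq_norm_sq hr
    rw [quantile_moments hLmean hLvar] at h
    exact ((sq_eq_sq₀ hσ0 (norm_nonneg _)).1 h).symm
  have hmono : MonotoneOn (fun u => a + σ * quantile F u) (Ioo 0 1) := fun u hu v hv huv =>
    add_le_add_right (mul_le_mul_of_nonneg_left (monotoneOn_quantile F hu hv huv) hσ0) a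
  have hW := le_wasserstein_map hmono (monotoneOn_quantile L) hfa hq
  rw [map_quantile, ← benchmark_eq_map] at hW
  replace hW := hW.trans hGW
  have hε0 : 0 ≤ ε x := by rw [hε]; have := sq_nonneg σ; nlinarith
  rw [ENNReal.ofReal_le_ofReal_iff (Real.sqrt_nonneg _), Real.sqrt_le_sqrt_iff hε0] at hW
  have hdist : ∫ u, (a + σ * quantile F u - quantile L u) ^ 2 ∂unif =
      ‖σ • hf.toLp - hr.toLp‖ ^ 2 := by
    rw [← MemLp.toLp_const_smul, ← MemLp.toLp_sub, ← integral_sq_eq_norm_sq]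
    refine integral_congr_ae (Filter.Eventually.of_forall fun u => ?_)
    simp only [Pi.sub_apply, Pi.smul_apply, smul_eq_mul]
    ring
  -- With `‖f‖ = 1` and `‖r‖ = σ`, `‖σf - r‖² = 2σ² - 2σ⟨r,f⟩`, which is at most `2σ²(1-b)`.
  have hfr : σ ^ 2 * b ≤ σ * inner ℝ hr.toLp hf.toLp := by
    rw [hdist, norm_sub_sq_real, norm_smul, hf1, hrn, real_inner_smul_left,
      real_inner_comm, hε, Real.norm_of_nonneg hσ0] at hW
    nlinarith
  have hrw := hup hr.toLp (by rw [inner_toLp_oneLp, hr0]) hrn hfr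
  rw [inner_toLp_toLp] at hrw
  rw [distortionRisk_eq_integral hg hac hsq L hq, EReal.coe_le_coe_iff]
  have hsplit : ∫ u, quantile L u * weight g u ∂unif =
      ∫ u, (quantile L u - a) * weight g u ∂unif + a := by
    have : ∀ u, quantile L u * weight g u =
        (quantile L u - a) * weight g u + a * weight g u := fun u => by ring
    have hi : Integrable (fun u => (quantile L u - a) * weight g u) unif := hr.integrable_mul hsq
    simp only [this]
    rw [integral_add hi ((hsq.integrable one_le_two).const_mul a),
      integral_const_mul, integral_weight_unif hg hac, mul_one]
  rw [hsplit]
  linarith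

/-- `X` need not be monotone: `(X, γ)` couples the law of `X` with that of γ, and the comonotone
coupling dominates it because concavity makes γ non-decreasing. -/
theorem le_distortionRisk_map (hg : IsDistortion g) (hconc : ConcaveOn ℝ (Icc 0 1) g)
    (hac : AbsolutelyContinuousOnInterval g 0 1) (hsq : MemLp (weight g) 2 unif)
    {X : ℝ → ℝ} (hX : MemLp X 2 unif) :
    ((∫ u, X u * weight g u ∂unif : ℝ) : EReal) ≤ distortionRisk g (unif.map X) := by
  have hXm := hX.aemeasurable
  have : IsProbabilityMeasure (unif.map X) := Measure.isProbabilityMeasure_map hXm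
  have hq : MemLp (quantile (unif.map X)) 2 unif :=
    memLp_quantile ((memLp_map_measure_iff (by fun_prop) hXm).2 hX)
  rw [distortionRisk_eq_integral hg hac hsq _ hq, EReal.coe_le_coe_iff]
  have h := (integral_mul_le_of_coupling (monotoneOn_quantile (unif.map X))
    (monotoneOn_weight hconc) hq hsq
    ((map_prodMk_fst hXm hsq.aemeasurable).trans (map_quantile _).symm)
    (map_prodMk_snd hXm hsq.aemeasurable)).2
  rwa [integral_map (hXm.prodMk hsq.aemeasurable) (by fun_prop)] at h

/-- The inner maximum over the feasible distributions, reduced to a problem in `L²(0,1)`. -/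
theorem isGreatest_riskValues (hg : IsDistortion g) (hconc : ConcaveOn ℝ (Icc 0 1) g)
    (hac : AbsolutelyContinuousOnInterval g 0 1) (hsq : MemLp (weight g) 2 unif)
    (hf : MemLp (quantile F) 2 unif) (hf1 : ‖hf.toLp‖ = 1) (hS : S.PosSemidef)
    (hε : ε x = 2 * portStd S x ^ 2 * (1 - b)) (hb : b ≤ 1)
    (hup : ∀ r : Lp ℝ 2 unif, inner ℝ r oneLp = 0 → ‖r‖ = portStd S x →
      portStd S x ^ 2 * b ≤ portStd S x * inner ℝ r hf.toLp → inner ℝ r hsq.toLp ≤ w)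
    (p : Lp ℝ 2 unif) (hp0 : inner ℝ p oneLp = 0) (hp1 : ‖p‖ = 1)
    (hpf : b ≤ inner ℝ p hf.toLp) (hpw : w ≤ portStd S x * inner ℝ p hsq.toLp) :
    IsGreatest (riskValues g F m S ε x) ((-portMean m x + w : ℝ) : EReal) := by
  set σ := portStd S x with hσ
  have hσ0 : 0 ≤ σ := Real.sqrt_nonneg _
  set a := -portMean m x with ha
  have hp : MemLp (p : ℝ → ℝ) 2 unif := Lp.memLp p
  have hpp : hp.toLp = p := Lp.toLp_coeFn p hp
  rw [← hpp] at hp0 hp1 hpf hpw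
  rw [inner_toLp_oneLp] at hp0
  have hX : MemLp (fun u => a + σ * p u) 2 unif := (memLp_const a).add (hp.const_mul σ)
  have hXm := hX.aemeasurable
  have hprob : IsProbabilityMeasure (unif.map fun u => a + σ * p u) :=
    Measure.isProbabilityMeasure_map hXm
  have hXmean : ∫ u, (a + σ * p u) ∂unif = a := by
    rw [integral_add (integrable_const a) ((hp.integrable one_le_two).const_mul σ),
      integral_const_mul, hp0]
    simp
  obtain ⟨G, hGm, hGL⟩ := exists_mem_momentSet_lossLaw_eq hS m x
    (unif.map fun u => a + σ * p u) ((memLp_map_measure_iff (by fun_prop) hXm).2 hX)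
    (by rw [integral_map hXm (by fun_prop), hXmean])
    (by
      rw [variance_map (by fun_prop) hXm]
      refine (variance_eq_integral hXm).trans ?_
      rw [hXmean]
      simp only [add_sub_cancel_left, mul_pow]
      rw [integral_const_mul, integral_sq_eq_norm_sq hp, hp1]
      ring)
  have hGf : G ∈ feasible F m S ε x := by
    refine ⟨hGm, ?_⟩
    rw [hGL, benchmark_eq_map]
    have hfa : MemLp (fun u => a + σ * quantile F u) 2 unif :=
      (memLp_const a).add (hf.const_mul σ)
    refine (wasserstein_map_le hfa hX).trans (ENNReal.ofReal_le_ofReal (Real.sqrt_le_sqrt ?_))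
    have hdist : ∫ u, (a + σ * quantile F u - (a + σ * p u)) ^ 2 ∂unif =
        σ ^ 2 * ‖hf.toLp - hp.toLp‖ ^ 2 := by
      rw [← MemLp.toLp_sub, ← integral_sq_eq_norm_sq, ← integral_const_mul]
      refine integral_congr_ae (Filter.Eventually.of_forall fun u => ?_)
      simp only [Pi.sub_apply]
      ring
    rw [hdist, norm_sub_sq_real, hf1, hp1, real_inner_comm, hε]
    nlinarith [mul_le_mul_of_nonneg_left hpf (sq_nonneg σ)]
  have hub := distortionRisk_lossLaw_le hg hac hsq hf hf1 hS hε hb hup hGf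
  -- Rearranging `p` could only increase the risk, but the upper bound already equals its value, so
  -- equality holds.
  refine ⟨⟨G, hGf, le_antisymm hub ?_⟩, ?_⟩
  · simp only [hGL]
    refine le_trans (EReal.coe_le_coe_iff.2 ?_) (le_distortionRisk_map hg hconc hac hsq hX)
    have hsplit : ∫ u, (a + σ * p u) * weight g u ∂unif =
        a + σ * ∫ u, p u * weight g u ∂unif := by
      have hi : Integrable (fun u => p u * weight g u) unif := hp.integrable_mul hsq
      simp only [add_mul, mul_assoc]
      rw [integral_add ((hsq.integrable one_le_two).const_mul a) (hi.const_mul σ), integral_const_mul, integral_const_mul,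
        integral_weight_unif hg hac, mul_one]
    rw [hsplit, ← inner_toLp_toLp hp hsq]
    linarith
  · rintro _ ⟨G', hG', rfl⟩
    exact distortionRisk_lossLaw_le hg hac hsq hf hf1 hS hε hb hup hG'

end InnerMax

/-! ### Maximising a linear functional over a spherical cap -/

section Hilbert

variable {E : Type*} [NormedAddCommGroup E] [InnerProductSpace ℝ E] {f k r : E} {σ b : ℝ}

/-- The equality case of Cauchy–Schwarz. -/
theorem eq_smul_of_sq_le_inner (hf : ‖f‖ = 1) (hr : ‖r‖ = σ)
    (h : σ ^ 2 ≤ σ * inner ℝ r f) : r = σ • f := by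
  have h2 : ‖r - σ • f‖ ^ 2 ≤ 0 := by
    rw [norm_sub_sq_real, norm_smul, real_inner_smul_right, hf, hr, Real.norm_eq_abs, mul_one,
      sq_abs]
    linarith
  have h3 : ‖r - σ • f‖ = 0 := by
    have := sq_nonneg ‖r - σ • f‖
    exact pow_eq_zero_iff two_ne_zero |>.1 (le_antisymm h2 this)
  exact sub_eq_zero.1 (norm_eq_zero.1 h3)

/-- The point of the unit sphere with prescribed inner product `b` with `f` that is closest to
`k`, as an element of the plane spanned by `f` and `k`. -/
theorem exists_cap_maximiser (hf : ‖f‖ = 1) (hk : ‖k‖ = 1) (hc : 0 ≤ inner ℝ f k)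
    (hcb : inner ℝ f k < b) (hb : b < 1) :
    ∃ μ ν : ℝ, μ ≤ 0 ∧ 0 < ν ∧ ‖k - μ • f‖ = ν ∧ inner ℝ (ν⁻¹ • (k - μ • f)) f = b ∧
      μ * b + ν = inner ℝ f k * b + √(1 - b ^ 2) * √(1 - inner ℝ f k ^ 2) ∧
      inner ℝ (ν⁻¹ • (k - μ • f)) k = μ * b + ν := by
  set c : ℝ := inner ℝ f k with hcdef
  have hb2 : 0 < 1 - b ^ 2 := by nlinarith
  have hc2 : 0 < 1 - c ^ 2 := by nlinarith
  set β := √(1 - b ^ 2) with hβ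
  set κ := √(1 - c ^ 2) with hκ
  have hβ0 : 0 < β := Real.sqrt_pos.2 hb2
  have hκ0 : 0 < κ := Real.sqrt_pos.2 hc2
  have hβs : β ^ 2 = 1 - b ^ 2 := Real.sq_sqrt hb2.le
  have hκs : κ ^ 2 = 1 - c ^ 2 := Real.sq_sqrt hc2.le
  have hβκ : β ≤ κ := Real.sqrt_le_sqrt (by nlinarith)
  -- Inner product `b` with `f` forces `c - μ = bν`; then `ν² = ‖k - μf‖² = (c - μ)² + κ²` gives `ν
  -- = κ/β`. Since `c < b` and `ν ≥ 1`, the multiplier `μ = c - bν` is nonpositive.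
  have hν : 0 < κ / β := div_pos hκ0 hβ0
  have hνβ : κ / β * β = κ := div_mul_cancel₀ _ hβ0.ne'
  set ν := κ / β with hνdef
  have hkf : inner ℝ k f = c := real_inner_comm f k
  have hν1 : 1 ≤ ν := (one_le_div hβ0).2 hβκ
  have hnorm : ‖k - (c - b * ν) • f‖ = ν := by
    rw [← sq_eq_sq₀ (norm_nonneg _) hν.le, norm_sub_sq_real, norm_smul, real_inner_smul_right, hf,
      hk, hkf, Real.norm_eq_abs, mul_one, sq_abs]
    have : ν ^ 2 * (1 - b ^ 2) = 1 - c ^ 2 := by rw [← hβs, ← hκs, ← mul_pow, hνβ]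
    linarith
  refine ⟨c - b * ν, ν, by nlinarith, hν, hnorm, ?_, ?_, ?_⟩
  · rw [real_inner_smul_left, inner_sub_left, real_inner_smul_left, hkf,
      real_inner_self_eq_norm_sq, hf]
    field_simp
    ring
  · have : ν * (1 - b ^ 2) = β * κ := by rw [← hβs, ← hνβ]; ring
    linarith
  · rw [real_inner_smul_left, inner_sub_left, real_inner_smul_left, ← hcdef,
      real_inner_self_eq_norm_sq, hk]
    have : 1 - c ^ 2 = ν ^ 2 * (1 - b ^ 2) := by rw [← hβs, ← hκs, ← mul_pow, hνβ]
    have h2 : 1 ^ 2 - (c - b * ν) * c = ν * ((c - b * ν) * b + ν) := by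
      linear_combination this
    rw [h2, inv_mul_cancel_left₀ hν.ne']

/-- Lagrangian duality: in `⟨r,k⟩ = μ⟨r,f⟩ + ⟨r, k - μf⟩` the first term is bounded by the cap
condition, as `μ ≤ 0`, and the second by Cauchy–Schwarz. -/
theorem inner_le_of_cap (hf : ‖f‖ = 1) (hk : ‖k‖ = 1) (hc : 0 ≤ inner ℝ f k)
    (hcb : inner ℝ f k < b) (hb : b < 1) (hr : ‖r‖ = σ) (h : σ ^ 2 * b ≤ σ * inner ℝ r f) :
    inner ℝ r k ≤ σ * (inner ℝ f k * b + √(1 - b ^ 2) * √(1 - inner ℝ f k ^ 2)) := by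
  obtain ⟨μ, ν, hμ, hν, hn, -, hval, -⟩ := exists_cap_maximiser hf hk hc hcb hb
  rw [← hval]
  have hσ : 0 ≤ σ := hr ▸ norm_nonneg r
  have hrf : σ * b ≤ inner ℝ r f := by
    rcases hσ.eq_or_lt with h0 | h0
    · have : r = 0 := norm_eq_zero.1 (hr.trans h0.symm)
      rw [← h0, this, inner_zero_left, zero_mul]
    · refine le_of_mul_le_mul_left ?_ h0
      linarith
  have hcs : inner ℝ r (k - μ • f) ≤ σ * ν := by
    have := real_inner_le_norm r (k - μ • f)
    rwa [hr, hn] at this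
  rw [inner_sub_right, real_inner_smul_right] at hcs
  nlinarith [mul_le_mul_of_nonpos_left hrf hμ]

end Hilbert

/-! ### The standardised weight function -/

section Weight

variable {g : ℝ → ℝ}

/-- Zero variance makes γ equal to its mean `1` almost everywhere. By monotonicity a value other
than `1` at one point would persist on a whole interval to its left or right. -/
theorem weightVar_pos (hg : IsDistortion g) (hconc : ConcaveOn ℝ (Icc 0 1) g)
    (hac : AbsolutelyContinuousOnInterval g 0 1) (hsq : MemLp (weight g) 2 unif)
    (hne : ∃ u ∈ Ioo (0 : ℝ) 1, weight g u ≠ 1) : 0 < weightVar g := by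
  refine (variance_nonneg _ _).lt_of_ne' fun h0 => ?_
  obtain ⟨u, hu, hu1⟩ := hne
  have hae := ae_eq_integral_of_variance_eq_zero hsq h0
  rw [integral_weight_unif hg hac] at hae
  have key : ∀ s t : ℝ, s < t → Ioo s t ⊆ Ioo 0 1 → ∃ v ∈ Ioo s t, weight g v = 1 :=
    fun s t hst hsub => by
    have hpos : unif (Ioo s t) ≠ 0 := by
      rw [unif, Measure.restrict_apply measurableSet_Ioo, inter_eq_left.2 hsub, Real.volume_Ioo]
      simpa using hst
    obtain ⟨v, hv, hv1⟩ := (frequently_ae_mem_iff.2 hpos).and_eventually hae |>.exists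
    exact ⟨v, hv, hv1⟩
  rcases lt_or_gt_of_ne hu1 with h | h
  · obtain ⟨v, hv, hv1⟩ := key 0 u hu.1 (Ioo_subset_Ioo_right hu.2.le)
    have := monotoneOn_weight hconc ⟨hv.1, hv.2.trans hu.2⟩ hu hv.2.le
    linarith
  · obtain ⟨v, hv, hv1⟩ := key u 1 hu.2 (Ioo_subset_Ioo_left hu.1.le)
    have := monotoneOn_weight hconc hu ⟨hu.1.trans hv.1, hv.2⟩ hv.1.le
    linarith

/-- The independent coupling has expected product zero, since `F` is centred, and the comonotone one
does at least as well. This yields `c₀ ≥ 0`. -/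
theorem integral_quantile_mul_weight_nonneg (hconc : ConcaveOn ℝ (Icc 0 1) g)
    (hsq : MemLp (weight g) 2 unif) {F : Measure ℝ} [IsProbabilityMeasure F]
    (hF2 : MemLp (fun z : ℝ => z) 2 F) (hFmean : ∫ z, z ∂F = 0) :
    0 ≤ ∫ u, quantile F u * weight g u ∂unif := by
  have hwm := hsq.aemeasurable
  have hprob : IsProbabilityMeasure (unif.map (weight g)) := Measure.isProbabilityMeasure_map hwm
  have h := (integral_mul_le_of_coupling (π := F.prod (unif.map (weight g)))
    (monotoneOn_quantile F) (monotoneOn_weight hconc) (memLp_quantile hF2) hsq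
    (by rw [map_quantile]; exact measurePreserving_fst.map_eq)
    measurePreserving_snd.map_eq).2
  rwa [integral_prod_mul (fun z : ℝ => z) (fun z : ℝ => z), hFmean, zero_mul] at h

/-- The standardised weight function in `L²(0,1)`. -/
noncomputable def stdWeight (hsq : MemLp (weight g) 2 unif) : Lp ℝ 2 unif :=
  (√(weightVar g))⁻¹ • (hsq.toLp - oneLp)

theorem norm_oneLp : ‖oneLp‖ = 1 := by
  have h := integral_sq_eq_norm_sq (memLp_const (1 : ℝ))
  simp only [one_pow, integral_const, probReal_univ, smul_eq_mul, mul_one] at h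
  exact ((sq_eq_sq₀ zero_le_one (norm_nonneg _)).1 ((one_pow 2).trans h)).symm

theorem inner_weight_oneLp (hg : IsDistortion g) (hac : AbsolutelyContinuousOnInterval g 0 1)
    (hsq : MemLp (weight g) 2 unif) : inner ℝ hsq.toLp oneLp = 1 := by
  rw [inner_toLp_oneLp, integral_weight_unif hg hac]

theorem inner_stdWeight_oneLp (hg : IsDistortion g) (hac : AbsolutelyContinuousOnInterval g 0 1)
    (hsq : MemLp (weight g) 2 unif) : inner ℝ (stdWeight hsq) oneLp = 0 := by
  rw [stdWeight, real_inner_smul_left, inner_sub_left, inner_weight_oneLp hg hac,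
    real_inner_self_eq_norm_sq, norm_oneLp]
  simp

theorem norm_stdWeight (hg : IsDistortion g) (hac : AbsolutelyContinuousOnInterval g 0 1)
    (hsq : MemLp (weight g) 2 unif) (hV : 0 < weightVar g) : ‖stdWeight hsq‖ = 1 := by
  have h : ‖hsq.toLp - oneLp‖ ^ 2 = weightVar g := by
    rw [weightVar, variance_eq_integral hsq.aemeasurable, integral_weight_unif hg hac, oneLp,
      ← MemLp.toLp_sub, ← integral_sq_eq_norm_sq]
    rfl
  rw [stdWeight, norm_smul, norm_inv, Real.norm_of_nonneg (Real.sqrt_nonneg _), ← h,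
    Real.sqrt_sq (norm_nonneg _)]
  refine inv_mul_cancel₀ fun h0 => ?_
  rw [h0] at h
  norm_num at h
  exact hV.ne h

theorem inner_weight_eq (hsq : MemLp (weight g) 2 unif) (hV : 0 < weightVar g)
    {r : Lp ℝ 2 unif} (hr : inner ℝ r oneLp = 0) :
    inner ℝ r hsq.toLp = √(weightVar g) * inner ℝ r (stdWeight hsq) := by
  rw [stdWeight, real_inner_smul_right, inner_sub_right, hr, sub_zero,
    mul_inv_cancel_left₀ (Real.sqrt_pos.2 hV).ne']

theorem corrCoeff_eq_inner (hsq : MemLp (weight g) 2 unif) (hV : 0 < weightVar g) {F : Measure ℝ}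
    [IsProbabilityMeasure F] (hf : MemLp (quantile F) 2 unif) (hFmean : ∫ z, z ∂F = 0)
    (hFvar : Var[fun z : ℝ => z; F] = 1) :
    corrCoeff F g = inner ℝ hf.toLp (stdWeight hsq) := by
  have hf0 : inner ℝ hf.toLp oneLp = 0 := by rw [inner_toLp_oneLp, integral_quantile, hFmean]
  have h := inner_weight_eq hsq hV hf0
  rw [inner_toLp_toLp] at h
  have hcov : cov[quantile F, weight g; unif] = ∫ u, quantile F u * weight g u ∂unif := by
    rw [covariance_eq_sub hf hsq, integral_quantile, hFmean]
    simp
  rw [corrCoeff, corr, hcov, variance_quantile, hFvar, h, Real.sqrt_one, one_mul]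
  exact mul_div_cancel_left₀ _ (Real.sqrt_pos.2 hV).ne'

end Weight

/-! ### The robust portfolio problem -/

section Robust

variable {n : ℕ} {g : ℝ → ℝ} {F : Measure ℝ} {m : Fin n → ℝ} {S : Matrix (Fin n) (Fin n) ℝ}
  {ε : (Fin n → ℝ) → ℝ} {P : Set (Fin n → ℝ)}

theorem robustProblemEquiv_of_isGreatest {obj : (Fin n → ℝ) → ℝ}
    (h : ∀ x ∈ P, IsGreatest (riskValues g F m S ε x) (obj x : EReal)) :
    RobustProblemEquiv g F m S ε P obj := by
  have hw : ∀ x ∈ P, worstCase g F m S ε x = (obj x : EReal) := fun x hx =>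
    (h x hx).isLUB.sSup_eq
  refine ⟨h, iInf_congr fun x => iInf_congr fun hx => hw x hx, fun x hx => ?_⟩
  simp only [isMinOn_iff]
  refine forall₂_congr fun y hy => ?_
  rw [hw x hx, hw y hy, EReal.coe_le_coe_iff]

/-- The cap problem is homogeneous in `σ`, so a single unit vector `p`, rescaled by `σ_x`, is
optimal for every portfolio. -/
theorem robustProblemEquiv_of_cap [IsProbabilityMeasure F] (hg : IsDistortion g)
    (hconc : ConcaveOn ℝ (Icc 0 1) g) (hac : AbsolutelyContinuousOnInterval g 0 1)
    (hsq : MemLp (weight g) 2 unif) (hV : 0 < weightVar g)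
    (hf : MemLp (quantile F) 2 unif) (hf1 : ‖hf.toLp‖ = 1) (hS : S.PosSemidef) {b t : ℝ}
    (hε : ∀ x ∈ P, ε x = 2 * portStd S x ^ 2 * (1 - b)) (hb : b ≤ 1)
    (hup : ∀ (r : Lp ℝ 2 unif) (σ : ℝ), ‖r‖ = σ → σ ^ 2 * b ≤ σ * inner ℝ r hf.toLp →
      inner ℝ r (stdWeight hsq) ≤ σ * t)
    (p : Lp ℝ 2 unif) (hp0 : inner ℝ p oneLp = 0) (hp1 : ‖p‖ = 1)
    (hpf : b ≤ inner ℝ p hf.toLp) (hpw : t ≤ inner ℝ p (stdWeight hsq)) :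
    RobustProblemEquiv g F m S ε P fun x =>
      -portMean m x + portStd S x * √(weightVar g) * t := by
  refine robustProblemEquiv_of_isGreatest fun x hx => ?_
  have hs := Real.sqrt_nonneg (weightVar g)
  refine isGreatest_riskValues hg hconc hac hsq hf hf1 hS (hε x hx) hb (fun r hr0 hr hrf => ?_)
    p hp0 hp1 hpf ?_
  · rw [inner_weight_eq hsq hV hr0, mul_comm (portStd S x), mul_assoc]
    exact mul_le_mul_of_nonneg_left (hup r _ hr hrf) hs
  · rw [inner_weight_eq hsq hV hp0, ← mul_assoc]
    exact mul_le_mul_of_nonneg_left hpw (mul_nonneg (Real.sqrt_nonneg _) hs)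

end Robust

end RobustPortfolio

theorem mainTheorem11 (n : ℕ)
    -- a concave, absolutely continuous distortion with square integrable weight, not constantly 1
    (g : ℝ → ℝ) (hg : RobustPortfolio.IsDistortion g)
    (hconc : ConcaveOn ℝ (Set.Icc 0 1) g)
    (hac : AbsolutelyContinuousOnInterval g 0 1)
    (hsq : MeasureTheory.MemLp (RobustPortfolio.weight g) 2 RobustPortfolio.unif)
    (hne : ∃ u ∈ Set.Ioo (0 : ℝ) 1, RobustPortfolio.weight g u ≠ 1)
    -- the standardised distribution generating the location-scale family
    (F : MeasureTheory.Measure ℝ) (hF : MeasureTheory.IsProbabilityMeasure F)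
    (hF2 : MeasureTheory.MemLp (fun z : ℝ => z) 2 F)
    (hFmean : ∫ z, z ∂F = 0)
    (hFvar : ProbabilityTheory.variance (fun z : ℝ => z) F = 1)
    -- mean vector, covariance matrix and set of portfolios
    (m : Fin n → ℝ) (S : Matrix (Fin n) (Fin n) ℝ) (hS : S.PosSemidef)
    (P : Set (Fin n → ℝ))
    (A : ℝ) (hA : A ∈ Set.Icc (0 : ℝ) 1)
    (ε : (Fin n → ℝ) → ℝ) (hε : ∀ x ∈ P, ε x = 2 * RobustPortfolio.portStd S x ^ 2 * A)
    (V c₀ : ℝ) (hV : V = RobustPortfolio.weightVar g)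
    (hc₀ : c₀ = RobustPortfolio.corrCoeff F g) :
    (A = 0 →
      RobustPortfolio.RobustProblemEquiv g F m S ε P fun x =>
        -RobustPortfolio.portMean m x + RobustPortfolio.portStd S x * √V * c₀) ∧
    (0 < A → A < 1 - c₀ →
      RobustPortfolio.RobustProblemEquiv g F m S ε P fun x =>
        -RobustPortfolio.portMean m x + RobustPortfolio.portStd S x * √V *
          (c₀ * (1 - A) + √(A * (2 - A)) * √(1 - c₀ ^ 2))) ∧
    (1 - c₀ ≤ A →
      RobustPortfolio.RobustProblemEquiv g F m S ε P fun x =>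
        -RobustPortfolio.portMean m x + RobustPortfolio.portStd S x * √V) := by
  have hV0 := RobustPortfolio.weightVar_pos hg hconc hac hsq hne
  have hf := RobustPortfolio.memLp_quantile hF2
  have hf0 : inner ℝ hf.toLp RobustPortfolio.oneLp = 0 := by
    rw [RobustPortfolio.inner_toLp_oneLp, RobustPortfolio.integral_quantile, hFmean]
  have hf1 : ‖hf.toLp‖ = 1 := by
    have h := RobustPortfolio.quantile_moments hFmean hFvar
    simp only [sub_zero] at h
    rw [RobustPortfolio.integral_sq_eq_norm_sq hf] at h
    exact (pow_eq_one_iff_of_nonneg (norm_nonneg _) two_ne_zero).1 h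
  have hk0 := RobustPortfolio.inner_stdWeight_oneLp hg hac hsq
  have hk1 := RobustPortfolio.norm_stdWeight hg hac hsq hV0
  have hc := RobustPortfolio.corrCoeff_eq_inner hsq hV0 hf hFmean hFvar
  have hc0 : 0 ≤ c₀ := by
    have h := RobustPortfolio.integral_quantile_mul_weight_nonneg hconc hsq hF2 hFmean
    rw [← RobustPortfolio.inner_toLp_toLp hf hsq,
      RobustPortfolio.inner_weight_eq hsq hV0 hf0, ← hc, ← hc₀] at h
    exact nonneg_of_mul_nonneg_right h (Real.sqrt_pos.2 hV0)
  rw [← hc₀] at hc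
  have hεb : ∀ x ∈ P, ε x = 2 * RobustPortfolio.portStd S x ^ 2 * (1 - (1 - A)) := by
    simpa using hε
  have hb : 1 - A ≤ 1 := by linarith [hA.1]
  subst hV
  refine ⟨fun hA0 => ?_, fun hA0 hA1 => ?_, fun hA1 => ?_⟩
  -- `A = 0`: the cap shrinks to the single point `σf`.
  · refine RobustPortfolio.robustProblemEquiv_of_cap hg hconc hac hsq hV0 hf hf1 hS hεb hb
      (fun r σ hr hrf => ?_) hf.toLp hf0 hf1 ?_ hc.le
    · rw [hA0, sub_zero, mul_one] at hrf
      rw [RobustPortfolio.eq_smul_of_sq_le_inner hf1 hr hrf, real_inner_smul_left, hc]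
    · rw [real_inner_self_eq_norm_sq, hf1]
      linarith
  -- `0 < A < 1 - c₀`: `k` lies outside the cap, and the optimum is on its boundary.
  · have hcb : inner ℝ hf.toLp (RobustPortfolio.stdWeight hsq) < 1 - A := by
      rw [← hc]; linarith
    have hc' := hc ▸ hc0
    have hsqrt : A * (2 - A) = 1 - (1 - A) ^ 2 := by ring
    rw [hsqrt]
    obtain ⟨μ, ν, -, hν, hn, hpf, hval, hpk⟩ :=
      RobustPortfolio.exists_cap_maximiser hf1 hk1 hc' hcb (by linarith)
    refine RobustPortfolio.robustProblemEquiv_of_cap hg hconc hac hsq hV0 hf hf1 hS hεb hb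
      (fun r σ hr hrf => ?_) _ ?_ ?_ hpf.ge ?_
    · rw [hc]
      exact RobustPortfolio.inner_le_of_cap hf1 hk1 hc' hcb (by linarith) hr hrf
    · rw [real_inner_smul_left, inner_sub_left, real_inner_smul_left, hk0, hf0]
      simp
    · rw [norm_smul, hn, norm_inv, Real.norm_of_nonneg hν.le, inv_mul_cancel₀ hν.ne']
    · rw [hpk, hval, hc]
  -- `1 - c₀ ≤ A`: `k` lies in the cap, so plain Cauchy–Schwarz is already sharp.
  · have h := RobustPortfolio.robustProblemEquiv_of_cap (m := m) hg hconc hac hsq hV0 hf hf1 hS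
      hεb hb (t := 1) (fun r σ hr _ => ?_) (RobustPortfolio.stdWeight hsq) hk0 hk1 ?_ ?_
    · simpa only [mul_one] using h
    · have := real_inner_le_norm r (RobustPortfolio.stdWeight hsq)
      rwa [hr, hk1] at this
    · rw [real_inner_comm, ← hc]
      linarith
    · rw [real_inner_self_eq_norm_sq, hk1, one_pow]
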